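/- Let $s\ge 0$ be an integer. For a binary word $x=x_1\cdots x_n\in\{0,1\}^n$ let $f(x)=(f(x)_1,\dots,f(x)_n)\in\mathbb{Z}^n$, $f(x)_i=\sum_{j=1}^i x_j$, be its accumulative sequence, and for $z\in\mathbb{Z}^n$ and $k\ge 0$ let $\mathrm{VT}^k(z)=\sum_{i=1}^n i^k z_i$. For $k\in\{0,1,\dots,2s\}$ put $n_k=(2s+1)\sum_{i=1}^n i^k$, and let $a_k\in\{0,1,\dots,n_k\}$. Then the code $$\mathcal{C}=\bigl\{x\in\{0,1\}^n:\ \mathrm{VT}^k(f(x))\equiv a_k \pmod{n_k+1}\ \text{ for all } k\in\{0,1,\dots,2s\}\bigr\}$$ is a binary single-deletion $s$-substitution correcting code; that is, for any two distinct codewords $x,y\in\mathcal{C}$, no word can be obtained both from $x$ and from $y$ by one deletion and $s$ substitutions (a substitution replaces a symbol by any symbol of $\{0,1\}$, possibly the same one; the errors may occur in any order). Moreover, for every $s$ there is a constant $K$ depending only on $s$ such that, for every $n\ge 1$, the residues $a_0,\dots,a_{2s}$ (with $0\le a_k\le n_k$) can be chosen so that $\mathcal{C}$ is non-empty and its redundancy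 $n-\log_2|\mathcal{C}|$ is at most $(s+1)(2s+1)\log_2 n+K$. -/

import Mathlib

namespace DelSub

/-- `y` arises from `x` by deleting one symbol. -/
def IsDeletion {α : Type*} (x y : List α) : Prop :=
  ∃ (u v : List α) (a : α), x = u ++ a :: v ∧ y = u ++ v

/-- `y` arises from `x` by replacing one symbol by a symbol of the alphabet
(possibly by the same symbol). -/
def IsSubstitution {α : Type*} (x y : List α) : Prop :=
  ∃ (u v : List α) (a b : α), x = u ++ a :: v ∧ y = u ++ b :: v

/-- `Reach t s x y`: the word `y` can be obtained from `x` by `t` deletions and `s`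
substitutions, performed in any order. -/
inductive Reach {α : Type*} : ℕ → ℕ → List α → List α → Prop
  | refl (x : List α) : Reach 0 0 x x
  | deletion {t s : ℕ} {x y z : List α} :
      Reach t s x y → IsDeletion y z → Reach (t + 1) s x z
  | substitution {t s : ℕ} {x y z : List α} :
      Reach t s x y → IsSubstitution y z → Reach t (s + 1) x z

/-- The `t`-deletion `s`-substitution ball of a word. -/
def ball {α : Type*} (t s : ℕ) (x : List α) : Set (List α) :=
  {y | Reach t s x y}

/-- A code of length `n` is a `t`-deletion `s`-substitution correcting code if the balls centred at
any two distinct codewords are disjoint. -/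
def IsCorrecting {α : Type*} {n : ℕ} (t s : ℕ) (C : Set (Fin n → α)) : Prop :=
  ∀ x ∈ C, ∀ y ∈ C, x ≠ y → Disjoint (ball t s (List.ofFn x)) (ball t s (List.ofFn y))

/-- The redundancy `n log q - log |C|` (in bits) of a code of length `n` over the `q`-ary alphabet
`{0, …, q - 1}`. -/
noncomputable def redundancy {q n : ℕ} (C : Set (Fin n → Fin q)) : ℝ :=
  (n : ℝ) * Real.logb 2 (q : ℝ) - Real.logb 2 (C.ncard : ℝ)

/-- The `k`-th order VT syndrome `∑ i^k z_i`, where positions are numbered from `1`. -/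
def VT {n : ℕ} (k : ℕ) (z : Fin n → ℤ) : ℤ :=
  ∑ i : Fin n, ((i : ℕ) + 1 : ℤ) ^ k * z i

/-- The accumulative sequence: its `i`-th entry is `x_1 + ⋯ + x_i`, computed in the integers. -/
def accumulative {q n : ℕ} (x : Fin n → Fin q) : Fin n → ℤ :=
  fun i => ∑ j ∈ Finset.Iic i, ((x j : ℕ) : ℤ)

/-- The number `(2s + 1) ∑_{i=1}^n i^k`. -/
def bound (n s k : ℕ) : ℕ :=
  (2 * s + 1) * ∑ i ∈ Finset.Icc 1 n, i ^ k

/-- The binary words of length `n` for which the VT syndromes of orders `0, …, 2s` of the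
accumulative sequence have the prescribed residues `a 0, …, a (2s)`. -/
def code (n s : ℕ) (a : Fin (2 * s + 1) → ℕ) : Set (Fin n → Fin 2) :=
  {x | ∀ k : Fin (2 * s + 1), VT k (accumulative x) ≡ (a k : ℤ) [ZMOD ((bound n s k : ℤ) + 1)]}

end DelSub

/-!
Let `x` and `y` be codewords whose balls meet and let `z = f(x) - f(y)`. The errors on each side can
be rearranged so that the deletion comes first; so, after deleting the symbol at position `d` from
`x` and the one at position `e` from `y`, the remaining words `x'` and `y'` differ in at most `2s`
places. By symmetry `d ≤ e`.

Let `g` be the sequence of partial sums of `x' - y'` and `a` the symbol deleted from `x`. Up to a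
shift of the index by one from position `d` on, `z` agrees with `g` up to an error between `a - 1`
and `a`. As `a ∈ {0, 1}`, the condition `1 ≤ g + a` decides the sign of `z` (weakly), and this
condition can change only where `x'` and `y'` differ. Hence `|z_i| ≤ 2s + 1`, and `z` has at most
`2s` sign changes (`exists_sign_pattern`).

The bound on `|z_i|` turns the congruences into `∑ i^k z_i = 0` for `k ≤ 2s`. A polynomial of degree
at most `2s` that has the same signs as `z` (`exists_polynomial_sign`) then gives a vanishing sum of
nonnegative terms, so `z = 0` (`eq_zero_of_moments_eq_zero`) and `x = y`.

For the redundancy, there are `∏ (n_k + 1) ≤ (2s + 2)^(2s + 1) n^((s + 1)(2s + 1))` vectors of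
residues, and by the pigeonhole principle one of the corresponding codes contains at least the
average number of words.
-/

open Polynomial

namespace DelSub

/-! ### Mismatches between words, and the normal form of an error pattern -/

/-- The number of indices below `m` at which two words differ. Entries past the end of a word are
`none`, so words of different lengths can be compared. -/
def mismatches {α : Type*} [DecidableEq α] (m : ℕ) (x y : List α) : ℕ :=
  ((Finset.range m).filter fun i => x[i]? ≠ y[i]?).card

lemma exists_eraseIdx_of_isDeletion {α : Type*} {x y : List α} (h : IsDeletion x y) :
    ∃ d, y = x.eraseIdx d := by
  obtain ⟨u, v, a, rfl, rfl⟩ := h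
  exact ⟨u.length, by simp [List.eraseIdx_append_of_length_le]⟩

section Mismatches

variable {α : Type*} [DecidableEq α]

lemma mismatches_self (m : ℕ) (x : List α) : mismatches m x x = 0 := by
  simp [mismatches]

lemma mismatches_comm (m : ℕ) (x y : List α) : mismatches m x y = mismatches m y x := by
  simp only [mismatches, ne_comm]

lemma mismatches_triangle (m : ℕ) (x y z : List α) :
    mismatches m x z ≤ mismatches m x y + mismatches m y z := by
  classical
  unfold mismatches
  refine (Finset.card_le_card ?_).trans (Finset.card_union_le _ _)
  intro i
  simp only [Finset.mem_filter, Finset.mem_union, Finset.mem_range]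
  grind

lemma mismatches_le_one_of_isSubstitution {x y : List α} (h : IsSubstitution x y) (m : ℕ) :
    mismatches m x y ≤ 1 := by
  obtain ⟨u, v, a, b, rfl, rfl⟩ := h
  unfold mismatches
  refine (Finset.card_le_card (t := {u.length}) ?_).trans (by simp)
  intro i
  simp only [Finset.mem_filter, Finset.mem_singleton, List.getElem?_append, List.getElem?_cons]
  grind

lemma mismatches_eraseIdx_le (m d : ℕ) (x y : List α) :
    mismatches m (x.eraseIdx d) (y.eraseIdx d) ≤ mismatches (m + 1) x y := by
  unfold mismatches
  refine Finset.card_le_card_of_injOn (fun i => if i < d then i else i + 1) ?_ ?_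
  · intro i
    simp only [Finset.coe_filter, Set.mem_ofPred_eq, Finset.mem_range, List.getElem?_eraseIdx]
    grind
  · intro i _ j _ h
    grind

lemma mismatches_le_of_reach_zero {t s : ℕ} {x y : List α} (h : Reach t s x y) (ht : t = 0)
    (m : ℕ) : mismatches m x y ≤ s := by
  induction h with
  | refl x => simp [mismatches_self]
  | deletion _ _ _ => omega
  | @substitution _ _ x y z _ hyz ih =>
    have h1 := mismatches_triangle m x y z
    have h2 := mismatches_le_one_of_isSubstitution hyz m
    have h3 := ih ht
    omega

/-- A deletion and `s` substitutions, in any order, amount to the deletion followed by at most `s`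
changes of symbols. -/
lemma exists_eraseIdx_of_reach_one {t s : ℕ} {x y : List α} (h : Reach t s x y) (ht : t = 1) :
    ∃ d, ∀ m, mismatches m (x.eraseIdx d) y ≤ s := by
  induction h with
  | refl x => omega
  | @deletion _ _ x y z hxy hyz _ =>
    obtain ⟨d, rfl⟩ := exists_eraseIdx_of_isDeletion hyz
    exact ⟨d, fun m => (mismatches_eraseIdx_le m d x y).trans
      (mismatches_le_of_reach_zero hxy (by omega) _)⟩
  | @substitution _ _ x y z _ hyz ih =>
    obtain ⟨d, hd⟩ := ih ht
    refine ⟨d, fun m => ?_⟩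
    have h1 := mismatches_triangle m (x.eraseIdx d) y z
    have h2 := mismatches_le_one_of_isSubstitution hyz m
    have h3 := hd m
    omega

end Mismatches

/-! ### Sign changes and polynomials -/

/-- The number of sign changes of `σ` between consecutive indices below `n`. -/
def signChanges (n : ℕ) (σ : ℕ → ℤ) : ℕ :=
  ((Finset.range (n - 1)).filter fun i => σ i ≠ σ (i + 1)).card

lemma exists_polynomial_sign (n : ℕ) (σ : ℕ → ℤ) (hσ : ∀ i, σ i = 1 ∨ σ i = -1) :
    ∃ P : ℤ[X], P.natDegree ≤ signChanges n σ ∧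
      ∀ i < n, 0 < σ i * P.eval ((i : ℤ) + 1) := by
  classical
  set T := (Finset.range (n - 1)).filter fun i => σ i ≠ σ (i + 1) with hT
  -- In the variable `i + 1`, the root for a change between `t` and `t + 1` lies at `t + 1/2`.
  set Q : ℤ[X] := ∏ t ∈ T, (C 2 * X - C (2 * (t : ℤ) + 3)) with hQ
  have hQe : ∀ i : ℤ, Q.eval (i + 1) = ∏ t ∈ T, (2 * (i - t) - 1) := by
    intro i
    rw [hQ, eval_prod]
    refine Finset.prod_congr rfl fun t _ => ?_
    simp only [eval_sub, eval_mul, eval_C, eval_X]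
    ring
  have hQ0 : Q.eval ((0 : ℤ) + 1) ≠ 0 := by
    rw [hQe]
    exact Finset.prod_ne_zero_iff.2 fun t _ => by omega
  have hfac : ∀ k : ℤ, k ≠ 0 → 0 < (2 * k - 1) * (2 * (k + 1) - 1) := by
    intro k hk
    rcases lt_or_gt_of_ne hk with h | h
    · exact mul_pos_of_neg_of_neg (by omega) (by omega)
    · exact mul_pos (by omega) (by omega)
  have hstep : ∀ i : ℕ, i + 1 < n →
      0 < σ i * σ (i + 1) * (Q.eval ((i : ℤ) + 1) * Q.eval (((i + 1 : ℕ) : ℤ) + 1)) := by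
    intro i hi
    have hprod : Q.eval ((i : ℤ) + 1) * Q.eval (((i + 1 : ℕ) : ℤ) + 1) =
        ∏ t ∈ T, (2 * ((i : ℤ) - t) - 1) * (2 * ((i : ℤ) - t + 1) - 1) := by
      rw [hQe, hQe, ← Finset.prod_mul_distrib]
      refine Finset.prod_congr rfl fun t _ => ?_
      push_cast
      ring
    rw [hprod]
    by_cases hiT : i ∈ T
    · have hne : σ i ≠ σ (i + 1) := (Finset.mem_filter.1 hiT).2
      have hs : σ i * σ (i + 1) = -1 := by
        rcases hσ i with h | h <;> rcases hσ (i + 1) with h' | h' <;> simp_all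
      rw [hs, ← Finset.mul_prod_erase T _ hiT]
      have : 0 < ∏ t ∈ T.erase i, (2 * ((i : ℤ) - t) - 1) * (2 * ((i : ℤ) - t + 1) - 1) := by
        refine Finset.prod_pos fun t ht => hfac _ ?_
        have := (Finset.mem_erase.1 ht).1
        omega
      simpa using this
    · have heq : σ i = σ (i + 1) := by
        by_contra hne
        exact hiT (Finset.mem_filter.2 ⟨Finset.mem_range.2 (by omega), hne⟩)
      have hs : σ i * σ (i + 1) = 1 := by
        rw [← heq]
        rcases hσ i with h | h <;> simp [h]
      rw [hs, one_mul]
      refine Finset.prod_pos fun t ht => hfac _ ?_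
      intro h0
      exact hiT (by rwa [show i = t by omega])
  -- The constant factor makes the sign at index `0` right.
  refine ⟨C (σ 0 * Q.eval ((0 : ℤ) + 1)) * Q, ?_, ?_⟩
  · refine (natDegree_C_mul_le _ _).trans ((natDegree_prod_le _ _).trans ?_)
    rw [signChanges, ← hT, Finset.card_eq_sum_ones]
    refine Finset.sum_le_sum fun t _ => ?_
    rw [natDegree_sub_C]
    exact (natDegree_C_mul_le _ _).trans natDegree_X_le
  · intro i
    induction i with
    | zero =>
      intro _
      have h0 : σ 0 ≠ 0 := by rcases hσ 0 with h | h <;> simp [h]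
      have h1 : σ 0 * Q.eval ((0 : ℤ) + 1) ≠ 0 := mul_ne_zero h0 hQ0
      have h2 := mul_self_pos.2 h1
      simp only [eval_mul, eval_C, Nat.cast_zero]
      linarith
    | succ i ih =>
      intro hi
      have h1 := mul_pos (ih (by omega)) (hstep i hi)
      simp only [eval_mul, eval_C] at h1 ⊢
      refine pos_of_mul_pos_left (b := (σ i * Q.eval ((i : ℤ) + 1)) ^ 2) ?_ (sq_nonneg _)
      linarith

/-- A sequence whose moments of orders `0, …, r` vanish and which has at most `r` sign changes is
zero. -/
lemma eq_zero_of_moments_eq_zero {n r : ℕ} (z σ : ℕ → ℤ) (hσ : ∀ i, σ i = 1 ∨ σ i = -1)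
    (hch : signChanges n σ ≤ r) (hz : ∀ i < n, 0 ≤ σ i * z i)
    (hmom : ∀ k ≤ r, ∑ i ∈ Finset.range n, ((i : ℤ) + 1) ^ k * z i = 0) :
    ∀ i < n, z i = 0 := by
  obtain ⟨P, hdeg, hP⟩ := exists_polynomial_sign n σ hσ
  have hsum : ∑ i ∈ Finset.range n, P.eval ((i : ℤ) + 1) * z i = 0 := by
    have hexp : ∀ i : ℕ, P.eval ((i : ℤ) + 1) * z i =
        ∑ k ∈ Finset.range (r + 1), P.coeff k * (((i : ℤ) + 1) ^ k * z i) := by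
      intro i
      rw [eval_eq_sum_range' (show P.natDegree < r + 1 by omega), Finset.sum_mul]
      exact Finset.sum_congr rfl fun k _ => by ring
    simp_rw [hexp]
    rw [Finset.sum_comm]
    refine Finset.sum_eq_zero fun k hk => ?_
    rw [← Finset.mul_sum, hmom k (by simpa [Nat.lt_succ_iff] using hk), mul_zero]
  have hσσ : ∀ i, σ i * σ i = 1 := fun i => by rcases hσ i with h | h <;> simp [h]
  have hnonneg : ∀ i ∈ Finset.range n, 0 ≤ P.eval ((i : ℤ) + 1) * z i := by
    intro i hi
    have hi' := Finset.mem_range.1 hi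
    have h := mul_nonneg (hP i hi').le (hz i hi')
    calc (0 : ℤ) ≤ _ := h
      _ = (σ i * σ i) * (P.eval ((i : ℤ) + 1) * z i) := by ring
      _ = _ := by rw [hσσ, one_mul]
  intro i hi
  have h0 := (Finset.sum_eq_zero_iff_of_nonneg hnonneg).1 hsum i (Finset.mem_range.2 hi)
  have hPi : P.eval ((i : ℤ) + 1) ≠ 0 := by
    intro h
    have := hP i hi
    simp [h] at this
  exact (mul_eq_zero.1 h0).resolve_left hPi

/-! ### Partial sums of two words after a deletion in each -/

/-- The index in the original sequence of the `j`-th entry that remains after the deletion of entry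
`d`. -/
def skip (d j : ℕ) : ℕ := if j < d then j else j + 1

lemma sum_range_skip_of_le (X : ℕ → ℤ) {d i : ℕ} (h : i ≤ d) :
    ∑ j ∈ Finset.range i, X (skip d j) = ∑ j ∈ Finset.range i, X j := by
  refine Finset.sum_congr rfl fun j hj => ?_
  rw [skip, if_pos (by have := Finset.mem_range.1 hj; omega)]

lemma sum_range_succ_eq_skip (X : ℕ → ℤ) {d i : ℕ} (h : d ≤ i) :
    ∑ j ∈ Finset.range (i + 1), X j = ∑ j ∈ Finset.range i, X (skip d j) + X d := by
  induction i, h using Nat.le_induction with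
  | base => rw [Finset.sum_range_succ, sum_range_skip_of_le X le_rfl]
  | succ i hi ih =>
    rw [Finset.sum_range_succ, ih, Finset.sum_range_succ _ i, skip, if_neg (by omega)]
    ring

/-- If two binary sequences become equal up to `r` mismatches after the deletion of entry `d` from
the first and entry `e ≥ d` from the second, then the difference of their accumulative sequences is
bounded by `r + 1` and changes its sign at most `r` times. -/
lemma exists_sign_pattern {n r d e : ℕ} (X Y : ℕ → ℤ) (hX : ∀ i, X i = 0 ∨ X i = 1)
    (hY : ∀ i, Y i = 0 ∨ Y i = 1) (hde : d ≤ e)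
    (hr : ((Finset.range n).filter fun j => X (skip d j) ≠ Y (skip e j)).card ≤ r) :
    (∀ i < n, |∑ j ∈ Finset.range (i + 1), X j - ∑ j ∈ Finset.range (i + 1), Y j| ≤ r + 1) ∧
    ∃ σ : ℕ → ℤ, (∀ i, σ i = 1 ∨ σ i = -1) ∧ signChanges n σ ≤ r ∧
      ∀ i < n, 0 ≤ σ i *
        (∑ j ∈ Finset.range (i + 1), X j - ∑ j ∈ Finset.range (i + 1), Y j) := by
  set D := (Finset.range n).filter fun j => X (skip d j) ≠ Y (skip e j) with hD
  set g : ℕ → ℤ := fun i => ∑ j ∈ Finset.range i, (X (skip d j) - Y (skip e j)) with hg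
  have hgsucc : ∀ i, g (i + 1) = g i + (X (skip d i) - Y (skip e i)) := fun i =>
    Finset.sum_range_succ _ i
  have hgsub : ∀ i, g i = ∑ j ∈ Finset.range i, X (skip d j) -
      ∑ j ∈ Finset.range i, Y (skip e j) := fun i => Finset.sum_sub_distrib _ _
  have hgabs : ∀ i ≤ n, |g i| ≤ r := by
    intro i hi
    calc |g i| ≤ ∑ j ∈ Finset.range i, |X (skip d j) - Y (skip e j)| :=
          Finset.abs_sum_le_sum_abs _ _
      _ ≤ ∑ j ∈ Finset.range n, |X (skip d j) - Y (skip e j)| :=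
          Finset.sum_le_sum_of_subset_of_nonneg (Finset.range_mono hi) fun _ _ _ => abs_nonneg _
      _ ≤ ∑ j ∈ Finset.range n, (if X (skip d j) ≠ Y (skip e j) then 1 else 0) := by
          refine Finset.sum_le_sum fun j _ => ?_
          rcases hX (skip d j) with h | h <;> rcases hY (skip e j) with h' | h' <;> simp [h, h']
      _ = (D.card : ℤ) := by rw [Finset.sum_boole]
      _ ≤ r := by exact_mod_cast hr
  -- The partial sums of the shortened sequences lag behind by one from the deleted entry on.
  set m : ℕ → ℕ := fun i => if i < d then i + 1 else i with hm
  have hmn : ∀ i < n, m i ≤ n := fun i hi => by simp only [hm]; split_ifs <;> omega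
  set z : ℕ → ℤ := fun i => ∑ j ∈ Finset.range (i + 1), X j - ∑ j ∈ Finset.range (i + 1), Y j
    with hz
  have hzg : ∀ i, X d - 1 ≤ z i - g (m i) ∧ z i - g (m i) ≤ X d := by
    intro i
    rcases lt_or_ge i d with hid | hid
    · have h : z i = g (i + 1) := by
        rw [hgsub, sum_range_skip_of_le X (by omega), sum_range_skip_of_le Y (by omega)]
      simp only [hm, if_pos hid, h]
      rcases hX d with h | h <;> omega
    · simp only [hm, if_neg (show ¬ i < d by omega)]
      rcases lt_or_ge i e with hie | hie
      · have h : z i = g i + X d - Y i := by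
          simp only [hz]
          rw [hgsub, sum_range_succ_eq_skip X hid, sum_range_skip_of_le Y hie.le,
            Finset.sum_range_succ Y]
          ring
        rcases hY i with h' | h' <;> omega
      · have h : z i = g i + X d - Y e := by
          simp only [hz]
          rw [hgsub, sum_range_succ_eq_skip X hid, sum_range_succ_eq_skip Y hie]
          ring
        rcases hY e with h' | h' <;> omega
  refine ⟨fun i hi => ?_, fun i => if 1 ≤ g (m i) + X d then 1 else -1, fun i => ?_, ?_,
    fun i _ => ?_⟩
  · change |z i| ≤ _
    have h1 := abs_le.1 (hgabs (m i) (hmn i hi))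
    have h2 := hzg i
    rw [abs_le]
    rcases hX d with h | h <;> constructor <;> omega
  · dsimp only
    split_ifs <;> simp
  · refine le_trans (Finset.card_le_card_of_injOn m ?_ ?_) hr
    · intro i hi
      simp only [Finset.coe_filter, Set.mem_ofPred_eq, Finset.mem_range] at hi
      obtain ⟨hin, hne⟩ := hi
      simp only [hD, Finset.coe_filter, Set.mem_ofPred_eq, Finset.mem_range]
      have hid : i + 1 ≠ d := by
        intro h
        apply hne
        simp only [hm, if_pos (show i < d by omega), if_neg (show ¬ i + 1 < d by omega)]
      have hms : m (i + 1) = m i + 1 := by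
        simp only [hm]
        split_ifs <;> omega
      refine ⟨?_, fun heq => hne ?_⟩
      · simp only [hm]
        split_ifs <;> omega
      · rw [hms, hgsucc, heq, sub_self, add_zero]
    · -- `m` takes the same value at `d - 1` and `d`, but there is no sign change at `d - 1`.
      intro i hi j hj hij
      simp only [Finset.coe_filter, Set.mem_ofPred_eq, Finset.mem_range] at hi hj
      have key : ∀ i, i + 1 = d → m i = m (i + 1) := by
        intro i h
        simp only [hm, if_pos (show i < d by omega), if_neg (show ¬ i + 1 < d by omega)]
      have hi' : i + 1 ≠ d := fun h => hi.2 (by rw [key i h])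
      have hj' : j + 1 ≠ d := fun h => hj.2 (by rw [key j h])
      simp only [hm] at hij
      split_ifs at hij <;> omega
  · change 0 ≤ (if 1 ≤ g (m i) + X d then 1 else -1) * z i
    have h2 := hzg i
    split_ifs with h
    · rcases hX d with h' | h' <;> omega
    · rcases hX d with h' | h' <;> omega

/-! ### The code corrects one deletion and `s` substitutions -/

/-- The entries of a binary word as integers, extended by zero past its end. -/
def entry (x : List (Fin 2)) (i : ℕ) : ℤ :=
  x[i]?.elim 0 fun a => ((a : ℕ) : ℤ)

lemma entry_eq_zero_or_one (x : List (Fin 2)) (i : ℕ) : entry x i = 0 ∨ entry x i = 1 := by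
  unfold entry
  cases x[i]? with
  | none => simp
  | some a => fin_cases a <;> simp

lemma entry_eraseIdx (x : List (Fin 2)) (d i : ℕ) :
    entry (x.eraseIdx d) i = entry x (skip d i) := by
  unfold entry skip
  rw [List.getElem?_eraseIdx]
  split_ifs <;> rfl

lemma entry_ofFn {n : ℕ} (x : Fin n → Fin 2) (i : Fin n) :
    entry (List.ofFn x) i = ((x i : ℕ) : ℤ) := by
  simp [entry]

lemma accumulative_eq_sum_entry {n : ℕ} (x : Fin n → Fin 2) (i : Fin n) :
    accumulative x i = ∑ j ∈ Finset.range ((i : ℕ) + 1), entry (List.ofFn x) j := by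
  unfold accumulative
  simp_rw [← entry_ofFn]
  refine Finset.sum_bij (fun j _ => (j : ℕ)) ?_ ?_ ?_ ?_
  · intro j hj
    have := Fin.le_def.1 (Finset.mem_Iic.1 hj)
    exact Finset.mem_range.2 (by omega)
  · intro j _ k _ h
    exact Fin.ext h
  · intro j hj
    have hj' := Finset.mem_range.1 hj
    have := i.isLt
    exact ⟨⟨j, by omega⟩, Finset.mem_Iic.2 (Fin.le_def.2 (by simp; omega)), rfl⟩
  · intro j _
    rfl

lemma accumulative_injective {n : ℕ} :
    Function.Injective (accumulative : (Fin n → Fin 2) → Fin n → ℤ) := by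
  intro x y h
  have hsum : ∀ i ≤ n, ∑ j ∈ Finset.range i, entry (List.ofFn x) j =
      ∑ j ∈ Finset.range i, entry (List.ofFn y) j := by
    intro i hi
    cases i with
    | zero => rfl
    | succ i =>
      have := congrFun h ⟨i, hi⟩
      rwa [accumulative_eq_sum_entry, accumulative_eq_sum_entry] at this
  funext i
  have h1 := hsum (i + 1) i.isLt
  rw [Finset.sum_range_succ, Finset.sum_range_succ, hsum i i.isLt.le, entry_ofFn, entry_ofFn] at h1
  exact Fin.ext (by omega)

/-- Moments of a sequence bounded by `2s + 1` are smaller than the moduli of the code, so that the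
congruences between syndromes are equalities. -/
lemma abs_moment_le_bound {n s : ℕ} (k : ℕ) (z : ℕ → ℤ)
    (hz : ∀ i < n, |z i| ≤ ((2 * s : ℕ) : ℤ) + 1) :
    |∑ i ∈ Finset.range n, ((i : ℤ) + 1) ^ k * z i| ≤ bound n s k := by
  have hI : Finset.Icc 1 n = Finset.Ico 1 (n + 1) := by
    ext
    simp only [Finset.mem_Icc, Finset.mem_Ico]
    omega
  have hb : (bound n s k : ℤ) =
      ∑ i ∈ Finset.range n, ((i : ℤ) + 1) ^ k * (((2 * s : ℕ) : ℤ) + 1) := by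
    rw [bound, hI, Finset.sum_Ico_eq_sum_range, Nat.add_sub_cancel, ← Finset.sum_mul]
    push_cast
    simp [mul_comm, add_comm]
  rw [hb]
  refine (Finset.abs_sum_le_sum_abs _ _).trans (Finset.sum_le_sum fun i hi => ?_)
  rw [abs_mul, abs_of_nonneg (show (0 : ℤ) ≤ ((i : ℤ) + 1) ^ k by positivity)]
  exact mul_le_mul_of_nonneg_left (hz i (Finset.mem_range.1 hi)) (by positivity)

lemma VT_accumulative_sub {n : ℕ} (k : ℕ) (x y : Fin n → Fin 2) :
    VT k (accumulative x) - VT k (accumulative y) =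
      ∑ i ∈ Finset.range n, ((i : ℤ) + 1) ^ k *
        (∑ j ∈ Finset.range (i + 1), entry (List.ofFn x) j -
          ∑ j ∈ Finset.range (i + 1), entry (List.ofFn y) j) := by
  unfold VT
  rw [← Finset.sum_sub_distrib, Finset.sum_range]
  refine Finset.sum_congr rfl fun i _ => ?_
  rw [accumulative_eq_sum_entry, accumulative_eq_sum_entry]
  ring

/-- Two codewords with the deletion position of the first not behind that of the second. -/
lemma eq_of_mismatches_eraseIdx_le {n s d e : ℕ} {a : Fin (2 * s + 1) → ℕ} {x y : Fin n → Fin 2}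
    (hx : x ∈ code n s a) (hy : y ∈ code n s a) (hde : d ≤ e)
    (h : mismatches n ((List.ofFn x).eraseIdx d) ((List.ofFn y).eraseIdx e) ≤ 2 * s) :
    x = y := by
  have hr : ((Finset.range n).filter fun j =>
      entry (List.ofFn x) (skip d j) ≠ entry (List.ofFn y) (skip e j)).card ≤ 2 * s := by
    refine (Finset.card_le_card ?_).trans h
    intro j
    simp only [Finset.mem_filter, ← entry_eraseIdx]
    rintro ⟨hj, hne⟩
    refine ⟨hj, fun heq => hne ?_⟩
    rw [entry, entry, heq]
  obtain ⟨habs, σ, hσ, hch, hsign⟩ := exists_sign_pattern _ _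
    (entry_eq_zero_or_one (List.ofFn x)) (entry_eq_zero_or_one (List.ofFn y)) hde hr
  have hzero := eq_zero_of_moments_eq_zero _ σ hσ hch hsign (fun k hk => by
    have hb := abs_moment_le_bound k _ habs
    rw [← VT_accumulative_sub k x y] at hb ⊢
    have hmod := (hy ⟨k, by omega⟩).trans (hx ⟨k, by omega⟩).symm
    exact Int.eq_zero_of_abs_lt_dvd hmod.dvd (by simpa using Int.lt_add_one_of_le hb))
  apply accumulative_injective
  funext i
  rw [accumulative_eq_sum_entry, accumulative_eq_sum_entry]
  exact sub_eq_zero.1 (hzero i i.isLt)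

lemma isCorrecting_code (n s : ℕ) (a : Fin (2 * s + 1) → ℕ) : IsCorrecting 1 s (code n s a) := by
  intro x hx y hy hxy
  rw [Set.disjoint_left]
  intro w hxw hyw
  obtain ⟨d, hd⟩ := exists_eraseIdx_of_reach_one hxw rfl
  obtain ⟨e, he⟩ := exists_eraseIdx_of_reach_one hyw rfl
  have h := mismatches_triangle n ((List.ofFn x).eraseIdx d) w ((List.ofFn y).eraseIdx e)
  rw [mismatches_comm n w] at h
  have h' : mismatches n ((List.ofFn x).eraseIdx d) ((List.ofFn y).eraseIdx e) ≤ 2 * s := by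
    have := hd n
    have := he n
    omega
  rcases le_total d e with hde | hde
  · exact hxy (eq_of_mismatches_eraseIdx_le hx hy hde h')
  · rw [mismatches_comm] at h'
    exact hxy (eq_of_mismatches_eraseIdx_le hy hx hde h').symm

/-! ### Redundancy -/

/-- The vector of residues whose code contains `x`. -/
def residues (n s : ℕ) (x : Fin n → Fin 2) (k : Fin (2 * s + 1)) : ℕ :=
  (VT k (accumulative x) % ((bound n s k : ℤ) + 1)).toNat

lemma cast_residues (n s : ℕ) (x : Fin n → Fin 2) (k : Fin (2 * s + 1)) :
    (residues n s x k : ℤ) = VT k (accumulative x) % ((bound n s k : ℤ) + 1) :=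
  Int.toNat_of_nonneg (Int.emod_nonneg _ (by omega))

lemma residues_le (n s : ℕ) (x : Fin n → Fin 2) (k : Fin (2 * s + 1)) :
    residues n s x k ≤ bound n s k := by
  have h := Int.emod_lt_of_pos (VT k (accumulative x)) (show 0 < (bound n s k : ℤ) + 1 by omega)
  rw [← cast_residues] at h
  omega

lemma bound_add_one_le {n : ℕ} (hn : 1 ≤ n) (s k : ℕ) :
    bound n s k + 1 ≤ (2 * s + 2) * n ^ (k + 1) := by
  have h1 : ∑ i ∈ Finset.Icc 1 n, i ^ k ≤ n ^ (k + 1) := by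
    calc ∑ i ∈ Finset.Icc 1 n, i ^ k ≤ ∑ _i ∈ Finset.Icc 1 n, n ^ k :=
          Finset.sum_le_sum fun i hi => Nat.pow_le_pow_left (Finset.mem_Icc.1 hi).2 k
      _ = n ^ (k + 1) := by simp [pow_succ, mul_comm]
  have h2 : 1 ≤ n ^ (k + 1) := Nat.one_le_pow _ _ hn
  have h3 := Nat.mul_le_mul_left (2 * s + 1) h1
  unfold bound
  linarith

lemma prod_bound_add_one_le {n : ℕ} (hn : 1 ≤ n) (s : ℕ) :
    ∏ k : Fin (2 * s + 1), (bound n s k + 1) ≤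
      (2 * s + 2) ^ (2 * s + 1) * n ^ ((s + 1) * (2 * s + 1)) := by
  have hexp : ∑ k : Fin (2 * s + 1), ((k : ℕ) + 1) = (s + 1) * (2 * s + 1) := by
    rw [← Finset.sum_range (fun k => k + 1)]
    have h := Finset.sum_range_succ' (fun k : ℕ => k) (2 * s + 1)
    rw [add_zero] at h
    rw [← h, Finset.sum_range_id, Nat.add_sub_cancel,
      show (2 * s + 1 + 1) * (2 * s + 1) = 2 * ((s + 1) * (2 * s + 1)) by ring,
      Nat.mul_div_cancel_left _ two_pos]
  calc ∏ k : Fin (2 * s + 1), (bound n s k + 1)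
      ≤ ∏ k : Fin (2 * s + 1), (2 * s + 2) * n ^ ((k : ℕ) + 1) :=
        Finset.prod_le_prod' fun k _ => bound_add_one_le hn s k
    _ = _ := by
        rw [Finset.prod_mul_distrib, Finset.prod_pow_eq_pow_sum, hexp]
        simp

/-- Some code contains at least the average number of words. -/
lemma exists_code_ncard_ge (n s : ℕ) :
    ∃ a : Fin (2 * s + 1) → ℕ, (∀ k, a k ≤ bound n s k) ∧
      2 ^ n ≤ (∏ k : Fin (2 * s + 1), (bound n s k + 1)) * (code n s a).ncard := by
  classical
  let A : Finset (Fin (2 * s + 1) → ℕ) :=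
    Fintype.piFinset fun k => Finset.range (bound n s k + 1)
  have hA : A.card = ∏ k : Fin (2 * s + 1), (bound n s k + 1) := by
    simp [A, Fintype.card_piFinset]
  have hmem : ∀ a, a ∈ A ↔ ∀ k, a k ≤ bound n s k := by
    intro a
    simp [A, Fintype.mem_piFinset]
  have hmaps : ∀ x ∈ (Finset.univ : Finset (Fin n → Fin 2)), residues n s x ∈ A := fun x _ =>
    (hmem _).2 (residues_le n s x)
  by_contra! hlt
  have hfib : ∀ a ∈ A,
      (Finset.univ.filter fun x : Fin n → Fin 2 => residues n s x = a).card ≤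
        (code n s a).ncard := by
    intro a _
    rw [← Set.ncard_coe_finset]
    refine Set.ncard_le_ncard ?_ (Set.toFinite _)
    intro x hx k
    have hxa : residues n s x = a := by simpa using hx
    rw [← hxa, cast_residues]
    exact (Int.mod_modEq _ _).symm
  have hApos : A.Nonempty := ⟨_, hmaps 0 (Finset.mem_univ _)⟩
  have hcard : 2 ^ n = ∑ a ∈ A,
      (Finset.univ.filter fun x : Fin n → Fin 2 => residues n s x = a).card := by
    rw [← Finset.card_eq_sum_card_fiberwise hmaps]
    simp
  have hfin : A.card * 2 ^ n < A.card * 2 ^ n := by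
    calc A.card * 2 ^ n
        ≤ A.card * ∑ a ∈ A, (code n s a).ncard :=
          Nat.mul_le_mul_left _ (hcard.le.trans (Finset.sum_le_sum hfib))
      _ = ∑ a ∈ A, A.card * (code n s a).ncard := Finset.mul_sum _ _ _
      _ < ∑ _a ∈ A, 2 ^ n := by
          refine Finset.sum_lt_sum_of_nonempty hApos fun a ha => ?_
          rw [hA]
          exact hlt a ((hmem a).1 ha)
      _ = A.card * 2 ^ n := by simp
  exact lt_irrefl _ hfin

lemma exists_code_redundancy_le (s : ℕ) {n : ℕ} (hn : 1 ≤ n) :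
    ∃ a : Fin (2 * s + 1) → ℕ, (∀ k, a k ≤ bound n s k) ∧ (code n s a).Nonempty ∧
      redundancy (code n s a) ≤ ((s : ℝ) + 1) * (2 * (s : ℝ) + 1) * Real.logb 2 (n : ℝ) +
        (2 * (s : ℝ) + 1) * Real.logb 2 (2 * (s : ℝ) + 2) := by
  obtain ⟨a, ha, hcard⟩ := exists_code_ncard_ge n s
  have hpos : 0 < (code n s a).ncard := by
    rcases Nat.eq_zero_or_pos (code n s a).ncard with h | h
    · rw [h, mul_zero] at hcard
      exact absurd hcard (by simp)
    · exact h
  refine ⟨a, ha, Set.nonempty_of_ncard_ne_zero hpos.ne', ?_⟩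
  have hle : (2 : ℝ) ^ n ≤ ((2 * s + 2) ^ (2 * s + 1) * (n : ℝ) ^ ((s + 1) * (2 * s + 1))) *
      ((code n s a).ncard : ℝ) := by
    exact_mod_cast hcard.trans (Nat.mul_le_mul_right _ (prod_bound_add_one_le hn s))
  have hn0 : (n : ℝ) ≠ 0 := by positivity
  have hc0 : ((code n s a).ncard : ℝ) ≠ 0 := by positivity
  have hs0 : (2 * (s : ℝ) + 2) ≠ 0 := by positivity
  have hlog := Real.logb_le_logb_of_le (b := 2) one_lt_two (by positivity) hle
  rw [Real.logb_mul (by positivity) hc0, Real.logb_mul (by positivity) (by positivity),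
    Real.logb_pow, Real.logb_pow, Real.logb_pow, Real.logb_self_eq_one one_lt_two] at hlog
  push_cast at hlog
  rw [redundancy, Nat.cast_ofNat, Real.logb_self_eq_one one_lt_two]
  linarith

end DelSub

theorem theorem2 (s : ℕ) :
    (∀ (n : ℕ) (a : Fin (2 * s + 1) → ℕ), (∀ k, a k ≤ DelSub.bound n s k) →
      DelSub.IsCorrecting 1 s (DelSub.code n s a)) ∧
    ∃ K : ℝ, ∀ n : ℕ, 1 ≤ n →
      ∃ a : Fin (2 * s + 1) → ℕ, (∀ k, a k ≤ DelSub.bound n s k) ∧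
        (DelSub.code n s a).Nonempty ∧
        DelSub.redundancy (DelSub.code n s a) ≤
          ((s : ℝ) + 1) * (2 * (s : ℝ) + 1) * Real.logb 2 (n : ℝ) + K :=
  ⟨fun n a _ => DelSub.isCorrecting_code n s a,
    _, fun _ hn => DelSub.exists_code_redundancy_le s hn⟩
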